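/- Let $n\in\mathbb N$, let $p\in[1,2]$, and let $f:\mathbb R^n\to\mathbb C$ be a smooth ($C^\infty$) function. Write $\Delta=\sum_{j=1}^n \partial^2/\partial x_j^2$ for the Laplacian on $\mathbb R^n$, $\Delta^m$ for its $m$-th iterate, and $\|\cdot\|_p$ for the norm of $L^p(\mathbb R^n)$ with respect to Lebesgue measure. Suppose that $\Delta^m f\in L^p(\mathbb R^n)$ for every integer $m\ge 0$, and that $$\sum_{m=1}^{\infty}\|\Delta^m f\|_p^{-\frac1{2m}}=\infty,$$ where a term with $\|\Delta^m f\|_p=0$ is read as $+\infty$. If there is a point $x_0\in\mathbb R^n$ at which $f$ and all its partial derivatives $$\partial^\alpha f=\frac{\partial^{\alpha_1+\cdots+\alpha_n}f}{\partial x_1^{\alpha_1}\cdots\partial x_n^{\alpha_n}},\qquad \alpha=(\alpha_1,\dots,\alpha_n),\ \alpha_j\in\{0,1,2,\dots\},$$ vanish, then $f(x)=0$ for every $x\in\mathbb R^n$. -/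

import Mathlib

open MeasureTheory
open scoped ENNReal ContDiff

/-- The partial derivative `∂f/∂x_j` of a function on `ℝⁿ`, as an operator on functions. -/
noncomputable def partialDeriv {n : ℕ} (j : Fin n) (f : EuclideanSpace ℝ (Fin n) → ℂ) :
    EuclideanSpace ℝ (Fin n) → ℂ :=
  fun x => fderiv ℝ f x (EuclideanSpace.single j (1 : ℝ))

/-- The mixed partial derivative `∂^α f = ∂_1^{α_1} ⋯ ∂_n^{α_n} f` of a function on `ℝⁿ`, for a
multi-index `α ∈ (ℕ ∪ {0})ⁿ`. -/
noncomputable def multiPartialDeriv {n : ℕ} (α : Fin n → ℕ)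
    (f : EuclideanSpace ℝ (Fin n) → ℂ) : EuclideanSpace ℝ (Fin n) → ℂ :=
  (List.finRange n).foldr (fun j g => (partialDeriv j)^[α j] g) f

/-!
Since `p ≤ 2`, every iterate `Δᵐ f` has an inverse Fourier transform that is a function (a bounded
one plus a square-integrable one), and integration by parts identifies it with `(-4π²‖ξ‖²)ᵐ h`,
where `h` is that of `f`. Hence the norms `‖Δᵐ f‖_p` control the even moments of `‖h‖` for a damped,
finite version of Lebesgue measure. All moments are then finite, they bound the derivatives of
`f = 𝓕 h`, and they form a log-convex sequence `M`; Carleman's inequality turns the divergence of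
`∑ ‖Δᵐ f‖_p ^ (-1 / (2m))` into that of `∑ M j / M (j + 1)`. The Denjoy–Carleman theorem, in Bang's
form, applied on the lines through `x₀` gives `f = 0`.
-/

/-! ### The Denjoy–Carleman theorem -/

section DenjoyCarleman

variable {F : Type*} [NormedAddCommGroup F] [NormedSpace ℝ F]

/-- The point `x` has *Bang degree* at least `k` for the function `g`, relative to bounds `M j` on
the derivatives `g⁽ʲ⁾`: the derivatives of order `j ≤ k` at `x` are smaller than `M j` by the
factor `e ^ (j - k)`. Bang's proof of quasi-analyticity follows the decay of the degree along the
line. -/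
def HasBangDegree (M : ℕ → ℝ) (g : ℝ → F) (k : ℕ) (x : ℝ) : Prop :=
  ∀ j ≤ k, ‖iteratedDeriv j g x‖ ≤ Real.exp (j - k) * M j

lemma norm_le_mul_exp_of_norm_deriv_le {u u' : ℝ → F} {A c x : ℝ}
    (hu : ∀ t, HasDerivAt u (u' t) t) (hx : ‖u x‖ ≤ A)
    (hu' : ∀ t, 0 ≤ t → ‖u' (x + t)‖ ≤ A * c * Real.exp (c * t)) {t : ℝ} (ht : 0 ≤ t) :
    ‖u (x + t)‖ ≤ A * Real.exp (c * t) := by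
  have hshift : ∀ s, HasDerivAt (fun s => u (x + s)) (u' (x + s)) s := fun s =>
    (hu (x + s)).comp_const_add x s
  have hexp : ∀ s, HasDerivAt (fun s => A * Real.exp (c * s)) (A * c * Real.exp (c * s)) s :=
    fun s => (((hasDerivAt_const_mul c).exp).const_mul A).congr_deriv (by ring)
  exact image_norm_le_of_norm_deriv_right_le_deriv_boundary
    (fun s _ => (hshift s).continuousAt.continuousWithinAt)
    (fun s _ => (hshift s).hasDerivWithinAt) (by simpa using hx) hexp
    (fun s hs => hu' s hs.1) ⟨ht, le_rfl⟩

lemma HasBangDegree.norm_iteratedDeriv_add_le {g : ℝ → F} (hg : ContDiff ℝ ∞ g) {M : ℕ → ℝ}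
    {k : ℕ} (hM : 0 ≤ M k) (hbound : ∀ t, ‖iteratedDeriv k g t‖ ≤ M k) {μ : ℝ} (hμ : 0 ≤ μ)
    (hratio : ∀ j < k, M (j + 1) ≤ M j * μ) {x : ℝ} (hx : HasBangDegree M g k x) {j : ℕ}
    (hj : j ≤ k) {h : ℝ} (hh : 0 ≤ h) :
    ‖iteratedDeriv j g (x + h)‖ ≤
      Real.exp (j - k) * M j * Real.exp (Real.exp 1 * μ * h) := by
  induction hj using Nat.decreasingInduction generalizing h with
  | self =>
    rw [sub_self, Real.exp_zero, one_mul]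
    exact (hbound _).trans (le_mul_of_one_le_right hM (Real.one_le_exp (by positivity)))
  | of_succ j hj ih =>
    have hderiv : ∀ t, HasDerivAt (iteratedDeriv j g) (iteratedDeriv (j + 1) g t) t := fun t => by
      rw [iteratedDeriv_succ]
      exact (hg.differentiable_iteratedDeriv j
        (by exact_mod_cast WithTop.coe_lt_top _) t).hasDerivAt
    refine norm_le_mul_exp_of_norm_deriv_le hderiv (hx j hj.le) (fun t ht => (ih ht).trans ?_) hh
    have hexp : Real.exp ((j + 1 : ℕ) - k) = Real.exp (j - k) * Real.exp 1 := by
      rw [← Real.exp_add]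
      push_cast
      ring_nf
    calc Real.exp ((j + 1 : ℕ) - k) * M (j + 1) * Real.exp (Real.exp 1 * μ * t)
        ≤ Real.exp ((j + 1 : ℕ) - k) * (M j * μ) * Real.exp (Real.exp 1 * μ * t) := by
          gcongr
          exact hratio j hj
      _ = Real.exp (j - k) * M j * (Real.exp 1 * μ) * Real.exp (Real.exp 1 * μ * t) := by
          rw [hexp]
          ring

lemma antitone_ratio_of_sq_le_mul {M : ℕ → ℝ} (hM : ∀ j, 0 < M j)
    (hconv : ∀ j, M (j + 1) ^ 2 ≤ M j * M (j + 2)) : Antitone fun j => M j / M (j + 1) := by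
  refine antitone_nat_of_succ_le fun j => ?_
  rw [div_le_div_iff₀ (hM _) (hM _), ← sq]
  exact hconv j

lemma HasBangDegree.add {g : ℝ → F} (hg : ContDiff ℝ ∞ g) {M : ℕ → ℝ} (hM : ∀ j, 0 < M j)
    (hconv : ∀ j, M (j + 1) ^ 2 ≤ M j * M (j + 2)) {k : ℕ}
    (hbound : ∀ t, ‖iteratedDeriv (k + 1) g t‖ ≤ M (k + 1)) {x : ℝ}
    (hx : HasBangDegree M g (k + 1) x) {h : ℝ} (hh : 0 ≤ h)
    (hhr : Real.exp 1 * h ≤ M k / M (k + 1)) : HasBangDegree M g k (x + h) := by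
  intro j hj
  have hratio : ∀ i < k + 1, M (i + 1) ≤ M i * (M (k + 1) / M k) := fun i hi => by
    have := antitone_ratio_of_sq_le_mul hM hconv (Nat.lt_succ_iff.mp hi)
    rwa [div_le_div_iff₀ (hM _) (hM _), mul_comm, ← le_div_iff₀ (hM k), mul_div_assoc] at this
  have hgrowth : Real.exp 1 * (M (k + 1) / M k) * h ≤ 1 := by
    rw [le_div_iff₀ (hM _)] at hhr
    rw [mul_div_assoc', div_mul_eq_mul_div, div_le_one (hM k)]
    linarith
  have hMj := (hM j).le
  calc ‖iteratedDeriv j g (x + h)‖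
      ≤ Real.exp (j - (k + 1 : ℕ)) * M j * Real.exp (Real.exp 1 * (M (k + 1) / M k) * h) :=
        hx.norm_iteratedDeriv_add_le hg (hM _).le hbound (div_pos (hM _) (hM k)).le hratio
          (Nat.le_succ_of_le hj) hh
    _ ≤ Real.exp (j - (k + 1 : ℕ)) * M j * Real.exp 1 := by gcongr
    _ = Real.exp (j - k) * M j := by
        rw [mul_right_comm, ← Real.exp_add]
        push_cast
        ring_nf

lemma hasBangDegree_of_le_sum_ratio {g : ℝ → F} (hg : ContDiff ℝ ∞ g) {M : ℕ → ℝ}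
    (hM : ∀ j, 0 < M j) (hconv : ∀ j, M (j + 1) ^ 2 ≤ M j * M (j + 2))
    (hbound : ∀ j t, ‖iteratedDeriv j g t‖ ≤ M j) (hzero : ∀ j, iteratedDeriv j g 0 = 0)
    (d k : ℕ) {x : ℝ} (hx : 0 ≤ x)
    (hxd : Real.exp 1 * x ≤ ∑ i ∈ Finset.range d, M (i + k) / M (i + k + 1)) :
    HasBangDegree M g k x := by
  have he := Real.exp_pos 1
  induction d generalizing k x with
  | zero =>
    obtain rfl : x = 0 := by
      rw [Finset.sum_range_zero] at hxd
      exact le_antisymm (nonpos_of_mul_nonpos_right hxd he) hx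
    intro j _
    rw [hzero j, norm_zero]
    exact mul_nonneg (Real.exp_pos _).le (hM j).le
  | succ d ih =>
    have hr : ∀ i, 0 ≤ M i / M (i + 1) := fun i => (div_pos (hM _) (hM _)).le
    rw [Finset.sum_range_succ', zero_add] at hxd
    simp only [add_right_comm _ 1 k] at hxd
    obtain ⟨y, hy, hyx, hyd, hxy⟩ : ∃ y, 0 ≤ y ∧ y ≤ x ∧
        Real.exp 1 * y ≤ ∑ i ∈ Finset.range d, M (i + (k + 1)) / M (i + (k + 1) + 1) ∧
        Real.exp 1 * (x - y) ≤ M k / M (k + 1) := by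
      simp only [← add_assoc]
      have hsum := Finset.sum_nonneg fun i (_ : i ∈ Finset.range d) => hr (i + k + 1)
      refine ⟨min x ((∑ i ∈ Finset.range d, M (i + k + 1) / M (i + k + 1 + 1)) / Real.exp 1),
        le_min hx (div_nonneg hsum he.le), min_le_left _ _, ?_, ?_⟩
      · rw [mul_comm, ← le_div_iff₀ he]
        exact min_le_right _ _
      · rw [mul_sub, sub_le_comm, mul_min_of_nonneg _ _ he.le, mul_div_cancel₀ _ he.ne']
        exact le_min (sub_le_self _ (hr k)) (sub_le_iff_le_add.mpr hxd)
    simpa using (ih (k + 1) hy hyd).add hg hM hconv (hbound _) (sub_nonneg.mpr hyx) hxy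

/-- The **Denjoy–Carleman theorem** for a log-convex sequence of uniform bounds. -/
theorem eq_zero_of_norm_iteratedDeriv_le {g : ℝ → F} (hg : ContDiff ℝ ∞ g) {M : ℕ → ℝ}
    (hM : ∀ j, 0 < M j) (hconv : ∀ j, M (j + 1) ^ 2 ≤ M j * M (j + 2))
    (hbound : ∀ j t, ‖iteratedDeriv j g t‖ ≤ M j) (hdiv : ¬ Summable fun j => M j / M (j + 1))
    (hzero : ∀ j, iteratedDeriv j g 0 = 0) {x : ℝ} (hx : 0 ≤ x) : g x = 0 := by
  have hdegree : ∀ k, HasBangDegree M g k x := fun k => by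
    have hdivk := mt (summable_nat_add_iff (f := fun j => M j / M (j + 1)) k).mp hdiv
    rw [not_summable_iff_tendsto_nat_atTop_of_nonneg fun i => (div_pos (hM _) (hM _)).le] at hdivk
    obtain ⟨d, hd⟩ := (hdivk.eventually_ge_atTop (Real.exp 1 * x)).exists
    exact hasBangDegree_of_le_sum_ratio hg hM hconv hbound hzero d k hx hd
  have hle : ∀ k : ℕ, ‖g x‖ ≤ Real.exp (-k) * M 0 := fun k => by
    simpa using hdegree k 0 (Nat.zero_le k)
  have hlim : Filter.Tendsto (fun k : ℕ => Real.exp (-k) * M 0) Filter.atTop (nhds (0 * M 0)) :=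
    (Real.tendsto_exp_neg_atTop_nhds_zero.comp tendsto_natCast_atTop_atTop).mul_const _
  rw [zero_mul] at hlim
  exact norm_le_zero_iff.mp (ge_of_tendsto' hlim hle)

end DenjoyCarleman

/-! ### Carleman's inequality -/

section Carleman

open Finset

/-- The weights in Pólya's proof of Carleman's inequality, chosen so that the geometric mean of the
first `k + 1` of them is exactly `k + 2`. -/
noncomputable def carlemanWeight (i : ℕ) : ℝ := (i + 2) ^ (i + 1) / (i + 1) ^ i

lemma carlemanWeight_nonneg (i : ℕ) : 0 ≤ carlemanWeight i := by
  unfold carlemanWeight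
  positivity

lemma prod_range_carlemanWeight (n : ℕ) : ∏ i ∈ range n, carlemanWeight i = (n + 1 : ℝ) ^ n := by
  induction n with
  | zero => simp
  | succ n ih =>
    rw [prod_range_succ, ih, carlemanWeight, mul_div_cancel₀ _ (by positivity)]
    push_cast
    ring

lemma carlemanWeight_le (i : ℕ) : carlemanWeight i ≤ Real.exp 1 * (i + 1) := by
  have hpow : ((i + 2 : ℝ) / (i + 1)) ^ (i + 1) ≤ Real.exp 1 := by
    calc ((i + 2 : ℝ) / (i + 1)) ^ (i + 1) = (1 / (i + 1 : ℝ) + 1) ^ (i + 1) := by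
          congr 1
          field_simp
          ring
      _ ≤ Real.exp (1 / (i + 1)) ^ (i + 1) := by
          gcongr
          exact Real.add_one_le_exp _
      _ = Real.exp 1 := by
          rw [← Real.exp_nat_mul]
          push_cast
          rw [mul_one_div_cancel (by positivity)]
  calc carlemanWeight i = ((i + 2 : ℝ) / (i + 1)) ^ (i + 1) * (i + 1) := by
        rw [carlemanWeight, div_pow, pow_succ (i + 1 : ℝ)]
        field_simp
    _ ≤ Real.exp 1 * (i + 1) := by gcongr

lemma geom_mean_le_carleman_mean {a : ℕ → ℝ} (ha : ∀ i, 0 ≤ a i) (k : ℕ) :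
    (∏ i ∈ range (k + 1), a i) ^ (1 / (k + 1 : ℝ)) ≤
      Real.exp 1 * ((∑ i ∈ range (k + 1), (i + 1) * a i) / ((k + 1) * (k + 2))) := by
  have hamgm := Real.geom_mean_le_arith_mean (range (k + 1)) (fun _ => 1)
    (fun i => carlemanWeight i * a i) (by simp)
    (by simp only [sum_const, card_range, nsmul_eq_mul, mul_one]; positivity)
    (fun i _ => mul_nonneg (carlemanWeight_nonneg i) (ha i))
  have hweight : (∏ i ∈ range (k + 1), carlemanWeight i) ^ (1 / (k + 1 : ℝ)) = k + 2 := by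
    rw [prod_range_carlemanWeight, one_div, ← Nat.cast_add_one k,
      Real.pow_rpow_inv_natCast (by positivity) k.succ_ne_zero]
    push_cast
    ring
  simp only [Real.rpow_one, one_mul, sum_const, card_range, nsmul_eq_mul, mul_one, Nat.cast_add,
    Nat.cast_one, prod_mul_distrib, ← one_div] at hamgm
  rw [Real.mul_rpow (prod_nonneg fun i _ => carlemanWeight_nonneg i)
    (prod_nonneg fun i _ => ha i), hweight] at hamgm
  calc (∏ i ∈ range (k + 1), a i) ^ (1 / (k + 1 : ℝ))
      ≤ (∑ i ∈ range (k + 1), carlemanWeight i * a i) / (k + 1) / (k + 2) := by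
        rwa [le_div_iff₀' (by positivity)]
    _ ≤ (∑ i ∈ range (k + 1), Real.exp 1 * (i + 1) * a i) / (k + 1) / (k + 2) := by
        gcongr with i _
        · exact ha i
        · exact carlemanWeight_le i
    _ = _ := by
        simp only [mul_assoc]
        rw [← mul_sum, div_div, mul_div_assoc]

lemma sum_partial_sum_div_eq (a : ℕ → ℝ) (n : ℕ) :
    ∑ k ∈ range n, (∑ i ∈ range (k + 1), (i + 1) * a i) / ((k + 1) * (k + 2)) =
      ∑ i ∈ range n, a i - (∑ i ∈ range n, (i + 1) * a i) / (n + 1) := by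
  induction n with
  | zero => simp
  | succ n ih =>
    rw [sum_range_succ, ih, sum_range_succ, sum_range_succ]
    push_cast
    field_simp
    ring

/-- **Carleman's inequality**. -/
theorem sum_geom_mean_le {a : ℕ → ℝ} (ha : ∀ i, 0 ≤ a i) (n : ℕ) :
    ∑ k ∈ range n, (∏ i ∈ range (k + 1), a i) ^ (1 / (k + 1 : ℝ)) ≤
      Real.exp 1 * ∑ i ∈ range n, a i := by
  calc ∑ k ∈ range n, (∏ i ∈ range (k + 1), a i) ^ (1 / (k + 1 : ℝ))
      ≤ ∑ k ∈ range n,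
          Real.exp 1 * ((∑ i ∈ range (k + 1), (i + 1) * a i) / ((k + 1) * (k + 2))) :=
        sum_le_sum fun k _ => geom_mean_le_carleman_mean ha k
    _ = Real.exp 1 * (∑ i ∈ range n, a i - (∑ i ∈ range n, (i + 1) * a i) / (n + 1)) := by
        rw [← mul_sum, sum_partial_sum_div_eq]
    _ ≤ Real.exp 1 * ∑ i ∈ range n, a i := by
        gcongr
        exact sub_le_self _ (div_nonneg
          (sum_nonneg fun i _ => mul_nonneg (by positivity) (ha i)) (by positivity))

lemma summable_geom_mean {a : ℕ → ℝ} (ha : ∀ i, 0 ≤ a i) (hs : Summable a) :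
    Summable fun k : ℕ => (∏ i ∈ range (k + 1), a i) ^ (1 / (k + 1 : ℝ)) :=
  summable_of_sum_range_le (c := Real.exp 1 * ∑' i, a i)
    (fun _ => Real.rpow_nonneg (prod_nonneg fun i _ => ha i) _)
    fun n => (sum_geom_mean_le ha n).trans <| by
      gcongr
      exact hs.sum_le_tsum _ fun i _ => ha i

lemma summable_rpow_neg_of_summable_ratio {M : ℕ → ℝ} (hM : ∀ j, 0 < M j) (hM0 : 1 ≤ M 0)
    (hs : Summable fun j => M j / M (j + 1)) :
    Summable fun k : ℕ => M (k + 1) ^ (-(1 / (k + 1 : ℝ))) := by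
  refine (summable_geom_mean (fun i => (div_pos (hM i) (hM (i + 1))).le) hs).of_nonneg_of_le
    (fun k => Real.rpow_nonneg (hM _).le _) fun k => ?_
  have htel : ∏ i ∈ range (k + 1), M i / M (i + 1) = M 0 / M (k + 1) := by
    induction k with
    | zero => simp
    | succ k ih => rw [prod_range_succ, ih, div_mul_div_cancel₀ (hM _).ne']
  have := hM (k + 1)
  rw [htel, Real.rpow_neg this.le, ← Real.inv_rpow this.le, inv_eq_one_div]
  gcongr

end Carleman

/-! ### Divergent series of negative powers -/

lemma tsum_max_one_rpow_neg_eq_top {a : ℕ → ℝ≥0∞} (ha : ∀ i, a i ≠ ⊤)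
    (hzero : ∀ i, a i = 0 → a (i + 1) = 0) {e : ℕ → ℝ} (hsum : ∑' i, a i ^ (-e i) = ⊤) :
    ∑' i, max 1 (a i) ^ (-e i) = ⊤ := by
  by_contra hne
  obtain ⟨N, hN⟩ := Filter.eventually_atTop.mp
    ((ENNReal.tendsto_atTop_zero_of_tsum_ne_top hne).eventually_lt_const one_pos)
  have hlarge : ∀ i, 1 < a (i + N) := fun i => by
    by_contra! hle
    simpa [max_eq_left hle] using hN (i + N) (Nat.le_add_left N i)
  have hpos : ∀ i, a i ≠ 0 := fun i hi => by
    have hprop : ∀ k, a (i + k) = 0 := fun k => by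
      induction k with
      | zero => exact hi
      | succ k ih => exact hzero _ ih
    simpa [hprop N] using hlarge i
  have htail : ∑' i, a (i + N) ^ (-e (i + N)) ≠ ⊤ := by
    refine ne_top_of_le_ne_top hne (le_of_eq_of_le (tsum_congr fun i => ?_)
      (ENNReal.tsum_comp_le_tsum_of_injective (add_left_injective N) fun i =>
        max 1 (a i) ^ (-e i)))
    rw [max_eq_right (hlarge i).le]
  refine ENNReal.add_ne_top.mpr ⟨?_, htail⟩
    ((ENNReal.summable.sum_add_tsum_nat_add' (k := N)).trans hsum)
  exact ENNReal.sum_ne_top.mpr fun i _ => ENNReal.rpow_ne_top_of_ne_zero (hpos i) (ha i)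

lemma rpow_neg_le_mul_rpow_neg {b c C : ℝ≥0∞} (hC1 : 1 ≤ C) (hC : C ≠ ⊤) (hc : c ≤ C * b) {e : ℝ}
    (he0 : 0 ≤ e) (he1 : e ≤ 1) : b ^ (-e) ≤ C * c ^ (-e) := by
  have hpow : c ^ e ≤ C * b ^ e :=
    calc c ^ e ≤ C ^ e * b ^ e := by
          rw [← ENNReal.mul_rpow_of_nonneg _ _ he0]
          gcongr
      _ ≤ C * b ^ e := by
          gcongr
          simpa using ENNReal.rpow_le_rpow_of_exponent_le hC1 he1
  rw [ENNReal.rpow_neg, ENNReal.rpow_neg, ← div_eq_mul_inv,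
    ← ENNReal.inv_div (.inl hC) (.inl (one_pos.trans_le hC1).ne'), ENNReal.inv_le_inv]
  exact ENNReal.div_le_of_le_mul' hpow

lemma not_summable_ratio_of_even_le {a : ℕ → ℝ≥0∞} (ha : ∀ i, a i ≠ ⊤)
    (hzero : ∀ i, a i = 0 → a (i + 1) = 0)
    (hsum : ∑' m : ℕ, a (m + 1) ^ (-(1 / (2 * ((m : ℝ) + 1)))) = ⊤) {M : ℕ → ℝ}
    (hM : ∀ j, 0 < M j) (hM0 : 1 ≤ M 0) {C : ℝ≥0∞} (hC1 : 1 ≤ C) (hC : C ≠ ⊤)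
    (hMa : ∀ m, ENNReal.ofReal (M (2 * m)) ≤ C * max 1 (a m)) :
    ¬ Summable fun j => M j / M (j + 1) := by
  intro hratio
  have hodd : Function.Injective fun m : ℕ => 2 * m + 1 := fun i j h => by simpa using h
  have heven : Summable fun m : ℕ => M (2 * (m + 1)) ^ (-(1 / (2 * ((m : ℝ) + 1)))) := by
    refine ((summable_rpow_neg_of_summable_ratio hM hM0 hratio).comp_injective hodd).congr
      fun m => ?_
    simp only [Function.comp_apply]
    push_cast
    ring_nf
  have hterm : ∀ m : ℕ, max 1 (a (m + 1)) ^ (-(1 / (2 * ((m : ℝ) + 1)))) ≤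
      C * ENNReal.ofReal (M (2 * (m + 1)) ^ (-(1 / (2 * ((m : ℝ) + 1))))) := fun m => by
    rw [← ENNReal.ofReal_rpow_of_pos (hM _)]
    refine rpow_neg_le_mul_rpow_neg hC1 hC (hMa _) (by positivity) ?_
    rw [div_le_one (by positivity)]
    linarith [(Nat.cast_nonneg m : (0 : ℝ) ≤ m)]
  refine (ENNReal.tsum_le_tsum hterm).trans_lt ?_ |>.ne
    (tsum_max_one_rpow_neg_eq_top (fun i => ha (i + 1)) (fun i => hzero (i + 1)) hsum)
  rw [ENNReal.tsum_mul_left]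
  exact ENNReal.mul_lt_top hC.lt_top heven.tsum_ofReal_lt_top

/-! ### Mixed partial derivatives -/

section PartialDerivatives

variable {n : ℕ} {u : EuclideanSpace ℝ (Fin n) → ℂ}

/-- The mixed partial derivative of order `α j` in each variable `x_j` listed in `l`; it
interpolates between `u` and `multiPartialDeriv α u` for the sake of induction. -/
noncomputable def listPartialDeriv (α : Fin n → ℕ) (l : List (Fin n))
    (u : EuclideanSpace ℝ (Fin n) → ℂ) : EuclideanSpace ℝ (Fin n) → ℂ :=
  l.foldr (fun j g => (partialDeriv j)^[α j] g) u

lemma listPartialDeriv_cons (α : Fin n → ℕ) (j : Fin n) (l : List (Fin n)) :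
    listPartialDeriv α (j :: l) u = (partialDeriv j)^[α j] (listPartialDeriv α l u) := rfl

lemma contDiff_partialDeriv (hu : ContDiff ℝ ∞ u) (i : Fin n) : ContDiff ℝ ∞ (partialDeriv i u) :=
  (hu.fderiv_right (m := ∞) le_rfl).clm_apply contDiff_const

lemma contDiff_iterate_partialDeriv (hu : ContDiff ℝ ∞ u) (i : Fin n) (k : ℕ) :
    ContDiff ℝ ∞ ((partialDeriv i)^[k] u) :=
  Function.Iterate.rec (ContDiff ℝ ∞ ·) hu (fun _ hv => contDiff_partialDeriv hv i) k

lemma contDiff_listPartialDeriv (hu : ContDiff ℝ ∞ u) (α : Fin n → ℕ) (l : List (Fin n)) :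
    ContDiff ℝ ∞ (listPartialDeriv α l u) := by
  induction l with
  | nil => exact hu
  | cons j l ih => exact contDiff_iterate_partialDeriv ih j _

lemma partialDeriv_partialDeriv_apply (hu : ContDiff ℝ ∞ u) (i j : Fin n)
    (x : EuclideanSpace ℝ (Fin n)) :
    partialDeriv i (partialDeriv j u) x =
      fderiv ℝ (fderiv ℝ u) x (EuclideanSpace.single i 1) (EuclideanSpace.single j 1) := by
  have hd := (hu.fderiv_right (m := ∞) le_rfl).differentiable (by simp) x
  unfold partialDeriv
  simp [fderiv_clm_apply hd (differentiableAt_const _)]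

lemma partialDeriv_comm (hu : ContDiff ℝ ∞ u) (i j : Fin n) :
    partialDeriv i (partialDeriv j u) = partialDeriv j (partialDeriv i u) := by
  ext x
  rw [partialDeriv_partialDeriv_apply hu, partialDeriv_partialDeriv_apply hu]
  exact (contDiff_infty.mp hu 2).contDiffAt.isSymmSndFDerivAt (by simp) _ _

lemma iterate_partialDeriv_comm (hu : ContDiff ℝ ∞ u) (i j : Fin n) (k : ℕ) :
    (partialDeriv j)^[k] (partialDeriv i u) = partialDeriv i ((partialDeriv j)^[k] u) := by
  induction k with
  | zero => rfl
  | succ k ih =>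
    rw [Function.iterate_succ_apply', ih, partialDeriv_comm (contDiff_iterate_partialDeriv hu j k),
      Function.iterate_succ_apply']

lemma listPartialDeriv_comm (hu : ContDiff ℝ ∞ u) (i : Fin n) (α : Fin n → ℕ)
    (l : List (Fin n)) :
    listPartialDeriv α l (partialDeriv i u) = partialDeriv i (listPartialDeriv α l u) := by
  induction l with
  | nil => rfl
  | cons j l ih =>
    rw [listPartialDeriv_cons, ih, iterate_partialDeriv_comm (contDiff_listPartialDeriv hu α l),
      listPartialDeriv_cons]

lemma listPartialDeriv_congr {α β : Fin n → ℕ} {l : List (Fin n)} (h : ∀ j ∈ l, α j = β j) :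
    listPartialDeriv α l u = listPartialDeriv β l u :=
  List.foldr_ext _ _ _ fun j hj v => by rw [h j hj]

lemma listPartialDeriv_partialDeriv (hu : ContDiff ℝ ∞ u) {i : Fin n} (α : Fin n → ℕ)
    {l : List (Fin n)} (hl : l.Nodup) (hi : i ∈ l) :
    listPartialDeriv α l (partialDeriv i u) =
      listPartialDeriv (Function.update α i (α i + 1)) l u := by
  induction l with
  | nil => simp at hi
  | cons j l ih =>
    rw [List.nodup_cons] at hl
    rw [listPartialDeriv_cons, listPartialDeriv_cons]
    rcases eq_or_ne i j with rfl | hij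
    · have hupdate : ∀ j ∈ l, Function.update α i (α i + 1) j = α j := fun j hj =>
        Function.update_of_ne (ne_of_mem_of_not_mem hj hl.1) _ _
      rw [listPartialDeriv_congr hupdate, Function.update_self, listPartialDeriv_comm hu,
        ← Function.iterate_succ_apply]
    · rw [ih hl.2 ((List.mem_cons.mp hi).resolve_left hij), Function.update_of_ne hij.symm]

lemma multiPartialDeriv_partialDeriv (hu : ContDiff ℝ ∞ u) (i : Fin n) (α : Fin n → ℕ) :
    multiPartialDeriv α (partialDeriv i u) =
      multiPartialDeriv (Function.update α i (α i + 1)) u :=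
  listPartialDeriv_partialDeriv hu α (List.nodup_finRange n) (List.mem_finRange i)

lemma multiPartialDeriv_zero : multiPartialDeriv 0 u = u :=
  List.foldr_fixed (List.finRange n)

lemma iteratedFDeriv_single_eq_zero {x₀ : EuclideanSpace ℝ (Fin n)} (hu : ContDiff ℝ ∞ u)
    (h : ∀ α : Fin n → ℕ, multiPartialDeriv α u x₀ = 0) (k : ℕ) (σ : Fin k → Fin n) :
    iteratedFDeriv ℝ k u x₀ (fun i => EuclideanSpace.single (σ i) 1) = 0 := by
  induction k generalizing u with
  | zero =>
    rw [iteratedFDeriv_zero_apply, ← multiPartialDeriv_zero (u := u)]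
    exact h 0
  | succ k ih =>
    let e : EuclideanSpace ℝ (Fin n) := EuclideanSpace.single (σ (Fin.last k)) 1
    have hpartial : iteratedFDeriv ℝ k (ContinuousLinearMap.apply ℝ ℂ e ∘ fderiv ℝ u) x₀
        (fun i => EuclideanSpace.single (σ i.castSucc) 1) = 0 :=
      ih (contDiff_partialDeriv hu (σ (Fin.last k)))
        (fun α => by rw [multiPartialDeriv_partialDeriv hu, h]) (fun i => σ i.castSucc)
    rw [ContinuousLinearMap.iteratedFDeriv_comp_left _
      (hu.fderiv_right (m := ∞) le_rfl).contDiffAt (i := k) (by exact_mod_cast le_top)] at hpartial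
    rw [iteratedFDeriv_succ_apply_right]
    exact hpartial

lemma iteratedFDeriv_eq_zero_of_multiPartialDeriv {x₀ : EuclideanSpace ℝ (Fin n)}
    (hu : ContDiff ℝ ∞ u) (h : ∀ α : Fin n → ℕ, multiPartialDeriv α u x₀ = 0) (k : ℕ) :
    iteratedFDeriv ℝ k u x₀ = 0 :=
  ContinuousMultilinearMap.toMultilinearMap_injective <|
    Module.Basis.ext_multilinear (fun _ => (EuclideanSpace.basisFun (Fin n) ℝ).toBasis) fun σ => by
      simpa using iteratedFDeriv_single_eq_zero hu h k σ

end PartialDerivatives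

/-! ### Integration by parts for the Laplacian -/

section WeakLaplacian

open Laplacian SchwartzMap Filter
open scoped Topology

variable {V : Type*} [NormedAddCommGroup V] [InnerProductSpace ℝ V] [FiniteDimensional ℝ V]

lemma contDiff_laplacian {F : Type*} [NormedAddCommGroup F] [NormedSpace ℝ F] {u : V → F}
    (hu : ContDiff ℝ ∞ u) : ContDiff ℝ ∞ (Δ u) := by
  rw [InnerProductSpace.laplacian_eq_iteratedFDeriv_stdOrthonormalBasis]
  have hderiv : ContDiff ℝ ∞ (iteratedFDeriv ℝ 2 u) := hu.iteratedFDeriv_right (by rfl)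
  exact ContDiff.sum fun i _ =>
    (ContinuousMultilinearMap.apply ℝ (fun _ : Fin 2 => V) F _).contDiff.comp hderiv

lemma contDiff_iterate_laplacian {F : Type*} [NormedAddCommGroup F] [NormedSpace ℝ F] {u : V → F}
    (hu : ContDiff ℝ ∞ u) (m : ℕ) : ContDiff ℝ ∞ (laplacian^[m] u) :=
  Function.Iterate.rec (ContDiff ℝ ∞ ·) hu (fun _ => contDiff_laplacian) m

lemma norm_laplacian_le {F : Type*} [NormedAddCommGroup F] [NormedSpace ℝ F] (w : V → F) (x : V) :
    ‖Δ w x‖ ≤ Module.finrank ℝ V * ‖iteratedFDeriv ℝ 2 w x‖ := by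
  rw [InnerProductSpace.laplacian_eq_iteratedFDeriv_stdOrthonormalBasis]
  calc ‖∑ i, iteratedFDeriv ℝ 2 w x ![stdOrthonormalBasis ℝ V i, stdOrthonormalBasis ℝ V i]‖
      ≤ ∑ _i : Fin (Module.finrank ℝ V), ‖iteratedFDeriv ℝ 2 w x‖ :=
        norm_sum_le_of_le _ fun i _ =>
          (ContinuousMultilinearMap.le_opNorm _ _).trans (by simp [Fin.prod_univ_two])
    _ = Module.finrank ℝ V * ‖iteratedFDeriv ℝ 2 w x‖ := by simp

/-- Smooth compactly supported cutoff functions that exhaust the space as `N` grows; as they are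
dilates of a single bump function, their derivatives are bounded uniformly in `N`. -/
noncomputable def dilatedBump (N : ℕ) (x : V) : ℝ :=
  (⟨1, 2, one_pos, one_lt_two⟩ : ContDiffBump (0 : V)) (((N : ℝ) + 1)⁻¹ • x)

lemma contDiff_dilatedBump (N : ℕ) : ContDiff ℝ ∞ (dilatedBump N : V → ℝ) :=
  (ContDiffBump.contDiff _).comp (contDiff_const_smul _)

lemma hasCompactSupport_dilatedBump (N : ℕ) : HasCompactSupport (dilatedBump N : V → ℝ) :=
  (ContDiffBump.hasCompactSupport _).comp_homeomorph
    (Homeomorph.smulOfNeZero _ (inv_ne_zero N.cast_add_one_ne_zero))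

lemma dilatedBump_eq_one {N : ℕ} {x : V} (hx : ‖x‖ ≤ N + 1) : dilatedBump N x = 1 := by
  refine ContDiffBump.one_of_mem_closedBall _ ?_
  rw [mem_closedBall_zero_iff, norm_smul, Real.norm_of_nonneg (by positivity),
    inv_mul_le_iff₀ (by positivity), mul_one]
  exact hx

lemma eventually_dilatedBump_eventuallyEq_one (x : V) :
    ∀ᶠ N in atTop, dilatedBump N =ᶠ[𝓝 x] fun _ => 1 := by
  filter_upwards [tendsto_natCast_atTop_atTop.eventually_gt_atTop ‖x‖] with N hN
  have hx : ‖x‖ < N + 1 := hN.trans (lt_add_one _)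
  filter_upwards [(isOpen_lt continuous_norm continuous_const).mem_nhds hx] with y hy
  exact dilatedBump_eq_one hy.le

lemma exists_norm_iteratedFDeriv_dilatedBump_le (j : ℕ) :
    ∃ K : ℝ, ∀ N (x : V), ‖iteratedFDeriv ℝ j (dilatedBump N) x‖ ≤ K := by
  let b : ContDiffBump (0 : V) := ⟨1, 2, one_pos, one_lt_two⟩
  obtain ⟨K, hK⟩ := (b.hasCompactSupport.iteratedFDeriv (𝕜 := ℝ) j).exists_bound_of_continuous
    (b.contDiff.continuous_iteratedFDeriv (n := ∞) (by exact_mod_cast le_top))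
  refine ⟨K, fun N x => ?_⟩
  let L : V →L[ℝ] V := ((N : ℝ) + 1)⁻¹ • ContinuousLinearMap.id ℝ V
  have hL : ‖L‖ ≤ 1 := by
    refine (norm_smul_le _ _).trans (mul_le_one₀ ?_ (norm_nonneg (ContinuousLinearMap.id ℝ V))
      ContinuousLinearMap.norm_id_le)
    rw [Real.norm_of_nonneg (by positivity)]
    exact inv_le_one_of_one_le₀ (by simp)
  calc ‖iteratedFDeriv ℝ j (b ∘ L) x‖
      ≤ ‖iteratedFDeriv ℝ j b (L x)‖ * ∏ _i : Fin j, ‖L‖ := by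
        rw [ContinuousLinearMap.iteratedFDeriv_comp_right L b.contDiff x
          (by exact_mod_cast le_top (a := (j : ℕ∞)))]
        exact ContinuousMultilinearMap.norm_compContinuousLinearMap_le _ _
    _ ≤ ‖iteratedFDeriv ℝ j b (L x)‖ := mul_le_of_le_one_right (norm_nonneg _)
        (Finset.prod_le_one (fun _ _ => norm_nonneg _) fun _ _ => hL)
    _ ≤ K := hK _

variable [MeasurableSpace V] [BorelSpace V]

lemma memLp_iteratedFDeriv {F : Type*} [NormedAddCommGroup F] [NormedSpace ℝ F] (ψ : 𝓢(V, F))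
    (k : ℕ) (q : ℝ≥0∞) : MemLp (iteratedFDeriv ℝ k ψ) q volume := by
  have hgrowth : (volume : Measure V).HasTemperateGrowth := inferInstance
  obtain ⟨m, hm⟩ := hgrowth.exists_eLpNorm_lt_top q
  have hpos : ∀ x : V, 0 < 1 + ‖x‖ := fun x => by positivity
  have hweight : MemLp (fun x : V => (1 + ‖x‖) ^ (-m : ℝ)) q volume :=
    ⟨(Continuous.rpow_const (by fun_prop) fun x => .inl (hpos x).ne').aestronglyMeasurable, hm⟩
  refine hweight.of_le_mul
    (c := 2 ^ m * (Finset.Iic (m, k)).sup (fun i => SchwartzMap.seminorm ℝ i.1 i.2) ψ)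
    ((ψ.smooth ⊤).continuous_iteratedFDeriv (by exact_mod_cast le_top)).aestronglyMeasurable
    (ae_of_all _ fun x => ?_)
  rw [Real.norm_of_nonneg (Real.rpow_nonneg (hpos x).le _), Real.rpow_neg (hpos x).le,
    Real.rpow_natCast, ← div_eq_mul_inv, le_div_iff₀' (pow_pos (hpos x) m)]
  exact one_add_le_sup_seminorm_apply (m := (m, k)) le_rfl le_rfl ψ x

lemma exists_memLp_norm_iteratedFDeriv_dilatedBump_smul_le {F : Type*} [NormedAddCommGroup F]
    [NormedSpace ℝ F] (ψ : 𝓢(V, F)) (k : ℕ) (q : ℝ≥0∞) :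
    ∃ g : V → ℝ, MemLp g q volume ∧
      ∀ N x, ‖iteratedFDeriv ℝ k (fun y => dilatedBump N y • ψ y) x‖ ≤ g x := by
  choose K hK using exists_norm_iteratedFDeriv_dilatedBump_le (V := V)
  refine ⟨fun x => ∑ i ∈ Finset.range (k + 1), k.choose i * K i * ‖iteratedFDeriv ℝ (k - i) ψ x‖,
    memLp_finsetSum _ fun i _ => (memLp_iteratedFDeriv ψ (k - i) q).norm.const_mul _,
    fun N x => ?_⟩
  refine (norm_iteratedFDeriv_smul_le (contDiff_dilatedBump N) (ψ.smooth ⊤) x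
    (by exact_mod_cast le_top)).trans (Finset.sum_le_sum fun i _ => ?_)
  gcongr
  exact hK i N x

variable {F : Type*} [NormedAddCommGroup F] [NormedSpace ℂ F]

lemma integral_smul_laplacian_of_hasCompactSupport {u : V → F} {w : V → ℂ} (hu : ContDiff ℝ ∞ u)
    (hw : ContDiff ℝ ∞ w) (hsupp : HasCompactSupport w) :
    ∫ x, w x • Δ u x = ∫ x, Δ w x • u x := by
  obtain ⟨r, hr⟩ := hsupp.isCompact.isBounded.subset_ball (0 : V)
  obtain ⟨N, hN⟩ := exists_nat_gt r
  have hone : ∀ x ∈ tsupport w, (fun y => dilatedBump N y • u y) =ᶠ[𝓝 x] u := fun x hx => by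
    filter_upwards [Metric.isOpen_ball.mem_nhds (hr hx)] with y hy
    rw [dilatedBump_eq_one (by linarith [mem_ball_zero_iff.mp hy]), one_smul]
  have hzero : ∀ x ∉ tsupport w, w x = 0 ∧ Δ w x = 0 := fun x hx => by
    have hw0 := notMem_tsupport_iff_eventuallyEq.mp hx
    refine ⟨hw0.eq_of_nhds, (InnerProductSpace.laplacian_congr_nhds hw0).eq_of_nhds.trans ?_⟩
    exact congrFun (InnerProductSpace.laplacian_const (c := (0 : ℂ))) x
  let v : V → F := fun y => dilatedBump N y • u y
  have hcongr : ∀ x, w x • Δ u x = w x • Δ v x ∧ Δ w x • v x = Δ w x • u x := fun x => by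
    by_cases hx : x ∈ tsupport w
    · exact ⟨congrArg _ (InnerProductSpace.laplacian_congr_nhds (hone x hx)).eq_of_nhds.symm,
        congrArg _ (hone x hx).eq_of_nhds⟩
    · simp only [hzero x hx, zero_smul, and_self]
  have hv : HasCompactSupport v := (hasCompactSupport_dilatedBump N).smul_right
  have hparts := integral_smul_laplacian_right_eq_left (μ := volume) (hsupp.toSchwartzMap hw)
    (hv.toSchwartzMap ((contDiff_dilatedBump N).smul hu))
  simp only [laplacian_apply] at hparts
  calc ∫ x, w x • Δ u x = ∫ x, w x • Δ v x := integral_congr_ae (ae_of_all _ fun x => (hcongr x).1)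
    _ = ∫ x, Δ w x • v x := hparts
    _ = ∫ x, Δ w x • u x := integral_congr_ae (ae_of_all _ fun x => (hcongr x).2)

lemma tendsto_integral_smul_of_norm_le_memLp {α : Type*} [MeasurableSpace α] {μ : Measure α}
    {p q : ℝ≥0∞} [p.HolderConjugate q] {v : α → F} (hv : MemLp v p μ) {φ : ℕ → α → ℂ} {φ' : α → ℂ}
    (hφ : ∀ N, AEStronglyMeasurable (φ N) μ) {g : α → ℝ} (hg : MemLp g q μ)
    (hbound : ∀ N x, ‖φ N x‖ ≤ g x) (hlim : ∀ x, ∀ᶠ N in atTop, φ N x = φ' x) :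
    Tendsto (fun N => ∫ x, φ N x • v x ∂μ) atTop (𝓝 (∫ x, φ' x • v x ∂μ)) := by
  refine tendsto_integral_of_dominated_convergence (fun x => ‖v x‖ * g x)
    (fun N => (hφ N).smul hv.1) (hv.norm.integrable_mul hg) (fun N => ae_of_all _ fun x => ?_)
    (ae_of_all _ fun x => ?_)
  · rw [norm_smul, mul_comm]
    gcongr
    exact hbound N x
  · refine tendsto_const_nhds.congr' ?_
    filter_upwards [hlim x] with N hN
    rw [hN]

lemma integral_smul_laplacian_of_memLp {u : V → F} (hu : ContDiff ℝ ∞ u) {p : ℝ≥0∞} (hp : 1 ≤ p)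
    (hup : MemLp u p volume) (hΔup : MemLp (Δ u) p volume) (ψ : 𝓢(V, ℂ)) :
    ∫ x, ψ x • Δ u x = ∫ x, Δ ψ x • u x := by
  have : p.HolderConjugate p.conjExponent := ENNReal.HolderConjugate.conjExponent hp
  let w : ℕ → V → ℂ := fun N x => dilatedBump N x • ψ x
  have hw : ∀ N, ContDiff ℝ ∞ (w N) := fun N => (contDiff_dilatedBump N).smul (ψ.smooth ⊤)
  have hw_eq : ∀ x, ∀ᶠ N in atTop, w N =ᶠ[𝓝 x] ψ := fun x => by
    filter_upwards [eventually_dilatedBump_eventuallyEq_one x] with N hN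
    filter_upwards [hN] with y hy
    rw [← one_smul ℝ (ψ y), ← hy]
  have hleft : Tendsto (fun N => ∫ x, w N x • Δ u x) atTop (𝓝 (∫ x, ψ x • Δ u x)) := by
    obtain ⟨g, hg, hwg⟩ :=
      exists_memLp_norm_iteratedFDeriv_dilatedBump_smul_le ψ 0 p.conjExponent
    simp only [norm_iteratedFDeriv_zero] at hwg
    exact tendsto_integral_smul_of_norm_le_memLp hΔup
      (fun N => (hw N).continuous.aestronglyMeasurable) hg hwg
      fun x => (hw_eq x).mono fun N => EventuallyEq.eq_of_nhds
  have hright : Tendsto (fun N => ∫ x, Δ (w N) x • u x) atTop (𝓝 (∫ x, Δ ψ x • u x)) := by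
    obtain ⟨g, hg, hwg⟩ :=
      exists_memLp_norm_iteratedFDeriv_dilatedBump_smul_le ψ 2 p.conjExponent
    exact tendsto_integral_smul_of_norm_le_memLp hup
      (fun N => (contDiff_laplacian (hw N)).continuous.aestronglyMeasurable)
      (hg.const_mul (Module.finrank ℝ V : ℝ))
      (fun N x => (norm_laplacian_le _ x).trans (by gcongr; exact hwg N x))
      fun x => (hw_eq x).mono fun N hN => by
        rw [laplacian_apply, (InnerProductSpace.laplacian_congr_nhds hN).eq_of_nhds]
  refine tendsto_nhds_unique hleft (hright.congr fun N => ?_)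
  exact (integral_smul_laplacian_of_hasCompactSupport hu (hw N)
    (hasCompactSupport_dilatedBump N).smul_right).symm

end WeakLaplacian

/-! ### The inverse Fourier transform on `L^p`, `1 ≤ p ≤ 2` -/

section LpDecomposition

variable {α : Type*} [MeasurableSpace α] {μ : Measure α} {F : Type*} [NormedAddCommGroup F]
  {u v : α → F} {p q : ℝ≥0∞}

lemma eLpNorm_le_eLpNorm_of_rpow_le_mul (hp : p ≠ 0) (hp' : p ≠ ⊤) (hq : q ≠ 0) (hq' : q ≠ ⊤)
    (h0 : eLpNorm u p μ ≠ 0) (htop : eLpNorm u p μ ≠ ⊤)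
    (h : ∀ x, ‖v x‖ₑ ^ q.toReal ≤
      eLpNorm u p μ ^ (q.toReal - p.toReal) * ‖u x‖ₑ ^ p.toReal) :
    eLpNorm v q μ ≤ eLpNorm u p μ := by
  set A := eLpNorm u p μ with hA
  have hint : ∫⁻ x, ‖u x‖ₑ ^ p.toReal ∂μ = A ^ p.toReal :=
    lintegral_rpow_enorm_eq_rpow_eLpNorm' (ENNReal.toReal_pos hp hp') |>.trans
      (by rw [hA, eLpNorm_eq_eLpNorm' hp hp'])
  rw [eLpNorm_eq_lintegral_rpow_enorm_toReal hq hq', one_div,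
    ENNReal.rpow_inv_le_iff (ENNReal.toReal_pos hq hq')]
  calc ∫⁻ x, ‖v x‖ₑ ^ q.toReal ∂μ
      ≤ ∫⁻ x, A ^ (q.toReal - p.toReal) * ‖u x‖ₑ ^ p.toReal ∂μ := lintegral_mono h
    _ = A ^ (q.toReal - p.toReal) * A ^ p.toReal := by
        rw [lintegral_const_mul' _ _ (ENNReal.rpow_ne_top_of_ne_zero h0 htop), hint]
    _ = A ^ q.toReal := by rw [← ENNReal.rpow_add _ _ h0 htop, sub_add_cancel]

lemma eLpNorm_indicator_lt_le_eLpNorm (hu : AEStronglyMeasurable u μ) (hq : q ≠ 0) (hqp : q ≤ p)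
    (hp : p ≠ ⊤) :
    eLpNorm ({x | eLpNorm u p μ < ‖u x‖ₑ}.indicator u) q μ ≤ eLpNorm u p μ := by
  have hp0 : p ≠ 0 := (hq.bot_lt.trans_le hqp).ne'
  have hqr : q.toReal ≤ p.toReal := ENNReal.toReal_mono hp hqp
  rcases eq_or_ne (eLpNorm u p μ) ⊤ with htop | htop
  · rw [htop]
    exact le_top
  rcases eq_or_ne (eLpNorm u p μ) 0 with h0 | h0
  · have hu0 : u =ᵐ[μ] 0 := (eLpNorm_eq_zero_iff hu hp0).mp h0
    refine (eLpNorm_indicator_le u).trans ?_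
    rw [eLpNorm_congr_ae hu0, eLpNorm_zero]
    exact zero_le
  refine eLpNorm_le_eLpNorm_of_rpow_le_mul hp0 hp hq (ne_top_of_le_ne_top hp hqp) h0 htop
    fun x => ?_
  by_cases hx : eLpNorm u p μ < ‖u x‖ₑ
  · rw [Set.indicator_of_mem (by exact hx)]
    calc ‖u x‖ₑ ^ q.toReal = ‖u x‖ₑ ^ (q.toReal - p.toReal) * ‖u x‖ₑ ^ p.toReal := by
          rw [← ENNReal.rpow_add _ _ (zero_le.trans_lt hx).ne' enorm_ne_top, sub_add_cancel]
      _ ≤ eLpNorm u p μ ^ (q.toReal - p.toReal) * ‖u x‖ₑ ^ p.toReal := by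
          gcongr ?_ * _
          rw [← neg_sub, ENNReal.rpow_neg, ENNReal.rpow_neg, ENNReal.inv_le_inv]
          exact ENNReal.rpow_le_rpow hx.le (sub_nonneg.mpr hqr)
  · rw [Set.indicator_of_notMem (by exact hx), enorm_zero,
      ENNReal.zero_rpow_of_pos (ENNReal.toReal_pos hq (ne_top_of_le_ne_top hp hqp))]
    exact zero_le

lemma eLpNorm_indicator_ge_le_eLpNorm (hp : p ≠ 0) (hpq : p ≤ q) (hq : q ≠ ⊤) :
    eLpNorm ({x | eLpNorm u p μ < ‖u x‖ₑ}ᶜ.indicator u) q μ ≤ eLpNorm u p μ := by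
  have hq0 : q ≠ 0 := (hp.bot_lt.trans_le hpq).ne'
  have hpr : p.toReal ≤ q.toReal := ENNReal.toReal_mono hq hpq
  rcases eq_or_ne (eLpNorm u p μ) ⊤ with htop | htop
  · rw [htop]
    exact le_top
  rcases eq_or_ne (eLpNorm u p μ) 0 with h0 | h0
  · have hzero : {x | eLpNorm u p μ < ‖u x‖ₑ}ᶜ.indicator u = 0 := by
      refine Set.indicator_eq_zero'.mpr (Set.disjoint_left.mpr fun x hx => not_not.mpr ?_)
      rw [Set.mem_ofPred_eq, h0]
      exact enorm_pos.mpr hx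
    rw [hzero, eLpNorm_zero]
    exact zero_le
  refine eLpNorm_le_eLpNorm_of_rpow_le_mul hp (ne_top_of_le_ne_top hq hpq) hq0 hq h0 htop
    fun x => ?_
  by_cases hx : eLpNorm u p μ < ‖u x‖ₑ
  · rw [Set.indicator_of_notMem (by exact fun h => h hx), enorm_zero,
      ENNReal.zero_rpow_of_pos (ENNReal.toReal_pos hq0 hq)]
    exact zero_le
  · rw [Set.indicator_of_mem (by exact hx)]
    calc ‖u x‖ₑ ^ q.toReal = ‖u x‖ₑ ^ (q.toReal - p.toReal) * ‖u x‖ₑ ^ p.toReal := by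
          rw [← ENNReal.rpow_add_of_nonneg _ _ (sub_nonneg.mpr hpr) ENNReal.toReal_nonneg,
            sub_add_cancel]
      _ ≤ eLpNorm u p μ ^ (q.toReal - p.toReal) * ‖u x‖ₑ ^ p.toReal := by
          gcongr ?_ * _
          exact ENNReal.rpow_le_rpow (not_lt.mp hx) (sub_nonneg.mpr hpr)

lemma eLpNorm_one_add_le {A : ℝ≥0∞} (hu : AEStronglyMeasurable u μ) (hv : AEStronglyMeasurable v μ)
    (huA : ∀ x, ‖u x‖ₑ ≤ A) (hvA : eLpNorm v 2 μ ≤ A) :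
    eLpNorm (u + v) 1 μ ≤ (μ Set.univ + μ Set.univ ^ (1 / 2 : ℝ)) * A := by
  calc eLpNorm (u + v) 1 μ ≤ eLpNorm u 1 μ + eLpNorm v 1 μ := eLpNorm_add_le hu hv le_rfl
    _ ≤ μ Set.univ * A + μ Set.univ ^ (1 / 2 : ℝ) * A := by
        gcongr
        · rw [eLpNorm_one_eq_lintegral_enorm, mul_comm, ← lintegral_const]
          exact lintegral_mono huA
        · calc eLpNorm v 1 μ ≤ eLpNorm v 2 μ * μ Set.univ ^ (1 / 2 : ℝ) := by
                refine (eLpNorm_le_eLpNorm_mul_rpow_measure_univ one_le_two hv).trans_eq ?_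
                norm_num
            _ ≤ μ Set.univ ^ (1 / 2 : ℝ) * A := by
                rw [mul_comm]
                gcongr
    _ = (μ Set.univ + μ Set.univ ^ (1 / 2 : ℝ)) * A := by rw [add_mul]

lemma measure_univ_add_rpow_ne_top [IsFiniteMeasure μ] :
    μ Set.univ + μ Set.univ ^ (1 / 2 : ℝ) ≠ ⊤ :=
  ENNReal.add_ne_top.mpr ⟨measure_ne_top _ _,
    ENNReal.rpow_ne_top_of_nonneg (by norm_num) (measure_ne_top _ _)⟩

end LpDecomposition

section WeakFourier

open FourierTransform Laplacian SchwartzMap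

variable {V : Type*} [NormedAddCommGroup V] [InnerProductSpace ℝ V] [FiniteDimensional ℝ V]
  [MeasurableSpace V] [BorelSpace V]

section NormedSpace

variable {F : Type*} [NormedAddCommGroup F] [NormedSpace ℂ F] {u v h k : V → F} {p : ℝ≥0∞}

lemma integrable_schwartz_smul (hu : MemLp u p volume) (hp : 1 ≤ p) (φ : 𝓢(V, ℂ)) :
    Integrable fun x => φ x • u x := by
  have : p.conjExponent.HolderConjugate p := (ENNReal.HolderConjugate.conjExponent hp).symm
  exact memLp_one_iff_integrable.mp (hu.smul (φ.memLp p.conjExponent volume))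

lemma locallyIntegrable_of_integrable_schwartz_smul
    (hh : ∀ φ : 𝓢(V, ℂ), Integrable fun x => φ x • h x) : LocallyIntegrable h := by
  refine locallyIntegrable_iff.mpr fun K hK => ?_
  obtain ⟨r, hr⟩ := hK.isBounded.exists_norm_le
  obtain ⟨N, hN⟩ := exists_nat_ge r
  have hsupp : HasCompactSupport fun x : V => (dilatedBump N x : ℂ) :=
    (hasCompactSupport_dilatedBump N).comp_left (g := Complex.ofReal) Complex.ofReal_zero
  have hsmooth : ContDiff ℝ ∞ fun x : V => (dilatedBump N x : ℂ) :=
    Complex.ofRealCLM.contDiff.comp (contDiff_dilatedBump N)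
  refine (hh (hsupp.toSchwartzMap hsmooth)).integrableOn.congr_fun (fun x hx => ?_)
    hK.measurableSet
  have hx1 : dilatedBump N x = 1 :=
    dilatedBump_eq_one ((hr x hx).trans (hN.trans (lt_add_one _).le))
  simp [hx1]

lemma ae_eq_of_integral_schwartz_smul_eq [CompleteSpace F] (hh : LocallyIntegrable h)
    (hk : LocallyIntegrable k)
    (heq : ∀ φ : 𝓢(V, ℂ), ∫ ξ, φ ξ • h ξ = ∫ ξ, φ ξ • k ξ) : h =ᵐ[volume] k := by
  refine ae_eq_of_integral_contDiff_smul_eq hh hk fun g hg hgs => ?_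
  have hsupp : HasCompactSupport fun x => (g x : ℂ) :=
    hgs.comp_left (g := Complex.ofReal) Complex.ofReal_zero
  have hsmooth : ContDiff ℝ ∞ fun x => (g x : ℂ) := Complex.ofRealCLM.contDiff.comp hg
  simpa using heq (hsupp.toSchwartzMap hsmooth)

/-- `IsWeakFourierInv u h` says that `h` is the inverse Fourier transform of `u` in the sense of
tempered distributions. The integrability fields ensure that `u` and `h` do define functionals on
the Schwartz space, so that the pairings are not junk values. -/
structure IsWeakFourierInv (u h : V → F) : Prop where
  integrable_smul_left (φ : 𝓢(V, ℂ)) : Integrable fun x => φ x • u x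
  integrable_smul_right (φ : 𝓢(V, ℂ)) : Integrable fun ξ => φ ξ • h ξ
  integral_smul (φ : 𝓢(V, ℂ)) : ∫ ξ, φ ξ • h ξ = ∫ x, (𝓕⁻ φ) x • u x

namespace IsWeakFourierInv

lemma add (huh : IsWeakFourierInv u h) (hvk : IsWeakFourierInv v k) :
    IsWeakFourierInv (u + v) (h + k) where
  integrable_smul_left φ := by
    simp only [Pi.add_apply, smul_add]
    exact (huh.integrable_smul_left φ).add (hvk.integrable_smul_left φ)
  integrable_smul_right φ := by
    simp only [Pi.add_apply, smul_add]
    exact (huh.integrable_smul_right φ).add (hvk.integrable_smul_right φ)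
  integral_smul φ := by
    simp only [Pi.add_apply, smul_add]
    rw [integral_add (huh.integrable_smul_right φ) (hvk.integrable_smul_right φ),
      integral_add (huh.integrable_smul_left _) (hvk.integrable_smul_left _),
      huh.integral_smul, hvk.integral_smul]

lemma aestronglyMeasurable (huh : IsWeakFourierInv u h) : AEStronglyMeasurable h volume :=
  (locallyIntegrable_of_integrable_schwartz_smul huh.integrable_smul_right).aestronglyMeasurable

lemma ae_eq [CompleteSpace F] (hh : IsWeakFourierInv u h) (hk : IsWeakFourierInv u k) :
    h =ᵐ[volume] k :=
  ae_eq_of_integral_schwartz_smul_eq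
    (locallyIntegrable_of_integrable_schwartz_smul hh.integrable_smul_right)
    (locallyIntegrable_of_integrable_schwartz_smul hk.integrable_smul_right)
    fun φ => (hh.integral_smul φ).trans (hk.integral_smul φ).symm

end IsWeakFourierInv

lemma continuous_fourier_of_integrable (hu : Integrable u) : Continuous (𝓕 u) :=
  VectorFourier.fourierIntegral_continuous Real.continuous_fourierChar
    (innerSL ℝ).continuous₂ hu

lemma continuous_fourierInv_of_integrable (hu : Integrable u) : Continuous (𝓕⁻ u) := by
  rw [funext (Real.fourierInv_eq_fourier_neg u)]
  exact (continuous_fourier_of_integrable hu).comp continuous_neg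

lemma enorm_fourierInv_le (u : V → F) (ξ : V) : ‖𝓕⁻ u ξ‖ₑ ≤ eLpNorm u 1 volume := by
  rw [Real.fourierInv_eq, eLpNorm_one_eq_lintegral_enorm]
  refine (enorm_integral_le_lintegral_enorm _).trans (lintegral_mono fun x => ?_)
  rw [← ofReal_norm, Circle.norm_smul, ofReal_norm]

lemma isWeakFourierInv_fourierInv [CompleteSpace F] (hu : Integrable u) :
    IsWeakFourierInv u (𝓕⁻ u) where
  integrable_smul_left := integrable_schwartz_smul (memLp_one_iff_integrable.mpr hu) le_rfl
  integrable_smul_right := integrable_schwartz_smul (p := ⊤)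
    (memLp_top_of_bound (continuous_fourierInv_of_integrable hu).aestronglyMeasurable
      (eLpNorm u 1 volume).toReal (.of_forall fun ξ => by
        rw [← toReal_enorm]
        exact ENNReal.toReal_mono (memLp_one_iff_integrable.mpr hu).2.ne
          (enorm_fourierInv_le u ξ))) le_top
  integral_smul φ := by
    have hflip : (-innerₗ V).flip = -innerₗ V := by
      ext x y
      simp [real_inner_comm]
    have := VectorFourier.integral_fourierIntegral_smul_eq_flip (μ := (volume : Measure V))
      (ν := (volume : Measure V)) (L := -innerₗ V) (f := ⇑φ) (g := u)
      Real.continuous_fourierChar continuous_inner.neg φ.integrable hu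
    rw [hflip] at this
    rw [fourierInv_coe]
    exact this.symm

lemma IsWeakFourierInv.eq_fourier [CompleteSpace F] (huh : IsWeakFourierInv u h)
    (hu : Continuous u) (hh : Integrable h) : u = 𝓕 h := by
  refine (Continuous.ae_eq_iff_eq volume hu (continuous_fourier_of_integrable hh)).mp ?_
  refine ae_eq_of_integral_schwartz_smul_eq hu.locallyIntegrable
    (continuous_fourier_of_integrable hh).locallyIntegrable fun φ => ?_
  have hflip := VectorFourier.integral_fourierIntegral_smul_eq_flip (μ := (volume : Measure V))
    (ν := (volume : Measure V)) (L := innerₗ V) (f := ⇑φ) (g := h)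
    Real.continuous_fourierChar continuous_inner φ.integrable hh
  rw [flip_innerₗ] at hflip
  calc ∫ x, φ x • u x = ∫ x, (𝓕⁻ (𝓕 φ)) x • u x := by rw [FourierTransform.fourierInv_fourier_eq]
    _ = ∫ ξ, (𝓕 φ) ξ • h ξ := (huh.integral_smul (𝓕 φ)).symm
    _ = ∫ x, φ x • 𝓕 h x := hflip

lemma laplacian_fourierInv (φ : 𝓢(V, ℂ)) :
    Δ (𝓕⁻ φ) = 𝓕⁻ (-(2 * Real.pi) ^ 2 • smulLeftCLM ℂ (fun ξ : V => ‖ξ‖ ^ 2) φ) := by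
  rw [SchwartzMap.laplacian_eq_fourierMultiplierCLM, fourierMultiplierCLM_apply,
    FourierTransform.fourier_fourierInv_eq]
  ext x
  simp only [smul_apply, fourierInv_coe]
  rw [Real.fourierInv_eq, Real.fourierInv_eq, ← integral_smul]
  exact integral_congr_ae (.of_forall fun ξ => smul_comm _ _ _)

lemma IsWeakFourierInv.laplacian (huh : IsWeakFourierInv u h)
    (hu : ContDiff ℝ ∞ u) (hp : 1 ≤ p) (hup : MemLp u p volume) (hΔup : MemLp (Δ u) p volume) :
    IsWeakFourierInv (Δ u) fun ξ => -(2 * Real.pi * ‖ξ‖) ^ 2 • h ξ := by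
  let mulSq (φ : 𝓢(V, ℂ)) : 𝓢(V, ℂ) :=
    -(2 * Real.pi) ^ 2 • smulLeftCLM ℂ (fun ξ : V => ‖ξ‖ ^ 2) φ
  have hmul (φ : 𝓢(V, ℂ)) :
      (fun ξ => φ ξ • -(2 * Real.pi * ‖ξ‖) ^ 2 • h ξ) = fun ξ => mulSq φ ξ • h ξ := by
    ext ξ
    simp only [mulSq, smul_apply,
      smulLeftCLM_apply_apply (Function.hasTemperateGrowth_norm_sq V), smul_smul]
    rw [smul_comm, ← smul_assoc, mul_pow (2 * Real.pi), neg_mul]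
  refine ⟨integrable_schwartz_smul hΔup hp, fun φ => ?_, fun φ => ?_⟩
  · rw [hmul]
    exact huh.integrable_smul_right _
  · rw [hmul, huh.integral_smul, integral_smul_laplacian_of_memLp hu hp hup hΔup,
      laplacian_fourierInv]

lemma IsWeakFourierInv.iterate_laplacian (huh : IsWeakFourierInv u h) (hu : ContDiff ℝ ∞ u)
    (hp : 1 ≤ p) (hLp : ∀ m, MemLp (Laplacian.laplacian^[m] u) p volume) (m : ℕ) :
    IsWeakFourierInv (Laplacian.laplacian^[m] u) fun ξ => (-(2 * Real.pi * ‖ξ‖) ^ 2) ^ m • h ξ := by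
  induction m with
  | zero => simpa using huh
  | succ m ih =>
    have hΔ := hLp (m + 1)
    rw [Function.iterate_succ_apply'] at hΔ ⊢
    simpa only [smul_smul, ← pow_succ']
      using ih.laplacian (contDiff_iterate_laplacian hu m) hp (hLp m) hΔ

end NormedSpace

section InnerProductSpace

variable {F : Type*} [NormedAddCommGroup F] [InnerProductSpace ℂ F] [CompleteSpace F]
  {u h : V → F} {p : ℝ≥0∞}

lemma isWeakFourierInv_fourierInv_toLp (hu : MemLp u 2 volume) :
    IsWeakFourierInv u (𝓕⁻ (hu.toLp u) : Lp F 2 (volume : Measure V)) where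
  integrable_smul_left := integrable_schwartz_smul hu one_le_two
  integrable_smul_right := integrable_schwartz_smul (Lp.memLp _) one_le_two
  integral_smul φ := by
    have hdistr := congrArg (fun T => T φ) (Lp.fourierInv_toTemperedDistribution_eq (hu.toLp u))
    simp only [TemperedDistribution.fourierInv_apply, Lp.toTemperedDistribution_apply] at hdistr
    rw [← hdistr]
    refine integral_congr_ae ?_
    filter_upwards [hu.coeFn_toLp] with x hx
    rw [hx]

lemma eLpNorm_fourierInv_toLp (hu : MemLp u 2 volume) :
    eLpNorm (𝓕⁻ (hu.toLp u) : Lp F 2 (volume : Measure V)) 2 volume = eLpNorm u 2 volume := by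
  have hnorm : ‖𝓕⁻ (hu.toLp u)‖ = ‖hu.toLp u‖ := by
    rw [← Lp.norm_fourier_eq, FourierTransform.fourier_fourierInv_eq]
  rw [← Lp.enorm_def, ← eLpNorm_congr_ae hu.coeFn_toLp, ← Lp.enorm_def, ← ofReal_norm, hnorm,
    ofReal_norm]

lemma exists_isWeakFourierInv_eLpNorm_one_le {ν : Measure V} (hν : ν ≤ volume) (hp1 : 1 ≤ p)
    (hp2 : p ≤ 2) (hu : MemLp u p volume) :
    ∃ h, IsWeakFourierInv u h ∧
      eLpNorm h 1 ν ≤ (ν Set.univ + ν Set.univ ^ (1 / 2 : ℝ)) * eLpNorm u p volume := by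
  set A := eLpNorm u p volume
  let s : Set V := {x | A < ‖u x‖ₑ}
  have hs : NullMeasurableSet s volume := nullMeasurableSet_lt aemeasurable_const hu.1.enorm
  have hlarge : eLpNorm (s.indicator u) 1 volume ≤ A :=
    eLpNorm_indicator_lt_le_eLpNorm hu.1 one_ne_zero hp1 (ne_top_of_le_ne_top (by simp) hp2)
  have hsmall : eLpNorm (sᶜ.indicator u) 2 volume ≤ A :=
    eLpNorm_indicator_ge_le_eLpNorm (one_pos.trans_le hp1).ne' hp2 (by simp)
  have hint : Integrable (s.indicator u) := memLp_one_iff_integrable.mp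
    ⟨hu.1.indicator₀ hs, hlarge.trans_lt hu.2⟩
  have hsq : MemLp (sᶜ.indicator u) 2 volume := ⟨hu.1.indicator₀ hs.compl, hsmall.trans_lt hu.2⟩
  let g : V → F := (𝓕⁻ (hsq.toLp _) : Lp F 2 (volume : Measure V))
  have hsum : IsWeakFourierInv u (𝓕⁻ (s.indicator u) + g) := by
    simpa only [Set.indicator_self_add_compl]
      using (isWeakFourierInv_fourierInv hint).add (isWeakFourierInv_fourierInv_toLp hsq)
  refine ⟨_, hsum, eLpNorm_one_add_le
    (continuous_fourierInv_of_integrable hint).aestronglyMeasurable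
    ((Lp.aestronglyMeasurable _).mono_measure hν)
    (fun ξ => (enorm_fourierInv_le _ ξ).trans hlarge) ?_⟩
  exact (eLpNorm_mono_measure _ hν).trans ((eLpNorm_fourierInv_toLp hsq).trans_le hsmall)

lemma IsWeakFourierInv.eLpNorm_one_le {ν : Measure V} (huh : IsWeakFourierInv u h) (hν : ν ≤ volume)
    (hp1 : 1 ≤ p) (hp2 : p ≤ 2) (hu : MemLp u p volume) :
    eLpNorm h 1 ν ≤ (ν Set.univ + ν Set.univ ^ (1 / 2 : ℝ)) * eLpNorm u p volume := by
  obtain ⟨k, huk, hk⟩ := exists_isWeakFourierInv_eLpNorm_one_le hν hp1 hp2 hu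
  rwa [eLpNorm_congr_ae ((huh.ae_eq huk).filter_mono (ae_mono hν))]

end InnerProductSpace

end WeakFourier

/-! ### Moments of the inverse Fourier transform -/

section Moments

open FourierTransform

lemma one_add_integral_pow_mul_sq_le {α : Type*} [MeasurableSpace α] {μ : Measure α} {s w : α → ℝ}
    (hs : ∀ x, 0 ≤ s x) (hw : ∀ x, 0 ≤ w x) (hi : ∀ j : ℕ, Integrable (fun x => s x ^ j * w x) μ)
    (j : ℕ) :
    (1 + ∫ x, s x ^ (j + 1) * w x ∂μ) ^ 2 ≤
      (1 + ∫ x, s x ^ j * w x ∂μ) * (1 + ∫ x, s x ^ (j + 2) * w x ∂μ) := by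
  set I : ℕ → ℝ := fun j => ∫ x, s x ^ j * w x ∂μ
  have hquad (t : ℝ) : 0 ≤ t ^ 2 * I j - 2 * t * I (j + 1) + I (j + 2) := by
    calc 0 ≤ ∫ x, s x ^ j * (s x - t) ^ 2 * w x ∂μ := integral_nonneg fun x =>
          mul_nonneg (mul_nonneg (pow_nonneg (hs x) _) (sq_nonneg _)) (hw x)
      _ = ∫ x, (t ^ 2 * (s x ^ j * w x) - 2 * t * (s x ^ (j + 1) * w x)) +
            s x ^ (j + 2) * w x ∂μ := by
          congr with x
          ring
      _ = t ^ 2 * I j - 2 * t * I (j + 1) + I (j + 2) := by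
          have hsub : Integrable
              (fun x => t ^ 2 * (s x ^ j * w x) - 2 * t * (s x ^ (j + 1) * w x)) μ :=
            ((hi _).const_mul _).sub ((hi _).const_mul _)
          rw [integral_add hsub (hi _), integral_sub ((hi _).const_mul _) ((hi _).const_mul _),
            integral_const_mul, integral_const_mul]
  have hdiscrim : discrim (1 + I j) (-2 * (1 + I (j + 1))) (1 + I (j + 2)) ≤ 0 :=
    discrim_le_zero fun t => by nlinarith [hquad t, sq_nonneg (1 - t)]
  rw [discrim] at hdiscrim
  linarith

section Truncation

variable {V : Type*} [NormedAddCommGroup V]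

/-- The size `2π‖ξ‖` of the frequency `ξ`, truncated from below at `1` so that its powers increase
with the exponent. -/
noncomputable def truncFreq (ξ : V) : ℝ :=
  max 1 (2 * Real.pi * ‖ξ‖)

lemma one_le_truncFreq (ξ : V) : 1 ≤ truncFreq ξ :=
  le_max_left _ _

lemma truncFreq_pos (ξ : V) : 0 < truncFreq ξ :=
  one_pos.trans_le (one_le_truncFreq ξ)

lemma continuous_truncFreq : Continuous (truncFreq : V → ℝ) := by
  unfold truncFreq
  fun_prop

lemma truncFreq_pow_le (ξ : V) (j : ℕ) : truncFreq ξ ^ j ≤ 1 + (2 * Real.pi * ‖ξ‖) ^ j := by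
  have hfreq : 0 ≤ (2 * Real.pi * ‖ξ‖) ^ j := by positivity
  rcases max_choice 1 (2 * Real.pi * ‖ξ‖) with h | h
  · rw [truncFreq, h, one_pow]
    linarith
  · rw [truncFreq, h]
    linarith

lemma measurable_inv_truncFreq_pow [MeasurableSpace V] [BorelSpace V] (Q : ℕ) :
    Measurable fun ξ : V => ENNReal.ofReal (truncFreq ξ ^ Q)⁻¹ :=
  ((continuous_truncFreq.measurable.pow_const Q).inv).ennreal_ofReal

lemma toReal_ofReal_inv_truncFreq_pow_smul (w : V → ℝ) (j Q : ℕ) (ξ : V) :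
    (ENNReal.ofReal (truncFreq ξ ^ Q)⁻¹).toReal • (truncFreq ξ ^ (j + Q) * w ξ) =
      truncFreq ξ ^ j * w ξ := by
  have hpos := pow_pos (truncFreq_pos ξ) Q
  rw [ENNReal.toReal_ofReal (inv_pos.mpr hpos).le, smul_eq_mul, pow_add, mul_assoc, mul_left_comm,
    inv_mul_cancel_left₀ hpos.ne']

end Truncation

variable {V : Type*} [NormedAddCommGroup V] [InnerProductSpace ℝ V] [FiniteDimensional ℝ V]
  [MeasurableSpace V] [BorelSpace V]

lemma integrable_inv_truncFreq_pow :
    Integrable fun ξ : V => (truncFreq ξ ^ (Module.finrank ℝ V + 1))⁻¹ := by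
  set Q := Module.finrank ℝ V + 1
  have hdecay : Integrable fun ξ : V => (1 + ‖ξ‖) ^ (-(Q : ℝ)) :=
    integrable_one_add_norm (by exact_mod_cast Nat.lt_succ_self _)
  refine (hdecay.const_mul (2 ^ Q)).mono'
    ((continuous_truncFreq.pow Q).inv₀ fun ξ =>
      (pow_pos (truncFreq_pos ξ) Q).ne').aestronglyMeasurable
    (.of_forall fun ξ => ?_)
  have hle : 1 + ‖ξ‖ ≤ 2 * truncFreq ξ := by
    have := le_max_right 1 (2 * Real.pi * ‖ξ‖)
    have := one_le_truncFreq ξ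
    unfold truncFreq at *
    nlinarith [Real.pi_gt_three, norm_nonneg ξ]
  have hpos := truncFreq_pos ξ
  rw [Real.norm_of_nonneg (by positivity), Real.rpow_neg (by positivity), Real.rpow_natCast,
    ← div_eq_mul_inv, ← one_div, div_le_div_iff₀ (by positivity) (by positivity), one_mul,
    ← mul_pow]
  gcongr

variable (V) in
/-- Lebesgue measure damped by just enough powers of the frequency to make it finite. -/
noncomputable def freqMeasure : Measure V :=
  volume.withDensity fun ξ => ENNReal.ofReal (truncFreq ξ ^ (Module.finrank ℝ V + 1))⁻¹

instance : IsFiniteMeasure (freqMeasure V) :=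
  isFiniteMeasure_withDensity_ofReal integrable_inv_truncFreq_pow.2

lemma freqMeasure_le_volume : freqMeasure V ≤ volume := by
  calc freqMeasure V ≤ volume.withDensity 1 := withDensity_mono (.of_forall fun ξ =>
        ENNReal.ofReal_le_one.mpr (inv_le_one_of_one_le₀ (one_le_pow₀ (one_le_truncFreq ξ))))
    _ = volume := withDensity_one

lemma integrable_freqMeasure_truncFreq_pow_mul_iff {w : V → ℝ} {j : ℕ} :
    Integrable (fun ξ => truncFreq ξ ^ (j + (Module.finrank ℝ V + 1)) * w ξ) (freqMeasure V) ↔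
      Integrable fun ξ => truncFreq ξ ^ j * w ξ := by
  rw [freqMeasure, integrable_withDensity_iff_integrable_smul' (measurable_inv_truncFreq_pow _)
    (.of_forall fun _ => ENNReal.ofReal_lt_top)]
  simp only [toReal_ofReal_inv_truncFreq_pow_smul]

lemma integral_freqMeasure_truncFreq_pow_mul (w : V → ℝ) (j : ℕ) :
    ∫ ξ, truncFreq ξ ^ (j + (Module.finrank ℝ V + 1)) * w ξ ∂freqMeasure V =
      ∫ ξ, truncFreq ξ ^ j * w ξ := by
  rw [freqMeasure, integral_withDensity_eq_integral_toReal_smul (measurable_inv_truncFreq_pow _)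
    (.of_forall fun _ => ENNReal.ofReal_lt_top)]
  simp only [toReal_ofReal_inv_truncFreq_pow_smul]

variable {F : Type*} [NormedAddCommGroup F]

lemma norm_iteratedFDeriv_fourier_le [NormedSpace ℂ F] {h : V → F}
    (hm : AEStronglyMeasurable h volume) (hi : ∀ j : ℕ, Integrable fun ξ => ‖ξ‖ ^ j * ‖h ξ‖)
    (j : ℕ) (x : V) :
    ‖iteratedFDeriv ℝ j (𝓕 h) x‖ ≤ ∫ ξ, (2 * Real.pi * ‖ξ‖) ^ j * ‖h ξ‖ := by
  rw [Real.iteratedFDeriv_fourier (N := ⊤) (fun k _ => hi k) hm le_top]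
  refine (VectorFourier.norm_fourierIntegral_le_integral_norm _ _ _ _ _).trans ?_
  refine integral_mono_of_nonneg (.of_forall fun _ => norm_nonneg _) ?_ (.of_forall fun ξ => ?_)
  · simpa only [mul_pow, mul_assoc] using (hi j).const_mul ((2 * Real.pi) ^ j)
  · calc _ ≤ (2 * Real.pi * ‖innerSL ℝ (E := V)‖) ^ j * ‖ξ‖ ^ j * ‖h ξ‖ :=
          VectorFourier.norm_fourierPowSMulRight_le _ _ _ _
      _ ≤ (2 * Real.pi * 1) ^ j * ‖ξ‖ ^ j * ‖h ξ‖ := by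
          gcongr
          exact norm_innerSL_le ℝ
      _ = (2 * Real.pi * ‖ξ‖) ^ j * ‖h ξ‖ := by rw [mul_one, mul_pow _ ‖ξ‖]

/-- The moments of `h` with respect to the finite measure `freqMeasure V`, increased by one to keep
them positive. -/
noncomputable def freqMoment (h : V → F) (j : ℕ) : ℝ :=
  1 + ∫ ξ, truncFreq ξ ^ j * ‖h ξ‖ ∂freqMeasure V

lemma one_le_freqMoment (h : V → F) (j : ℕ) : 1 ≤ freqMoment h j :=
  le_add_of_nonneg_right (integral_nonneg fun ξ => by
    have := truncFreq_pos ξ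
    positivity)

lemma norm_iteratedFDeriv_fourier_le_freqMoment [NormedSpace ℂ F] {h : V → F}
    (hm : AEStronglyMeasurable h volume)
    (hi : ∀ j : ℕ, Integrable (fun ξ => truncFreq ξ ^ j * ‖h ξ‖)) (j : ℕ) (x : V) :
    ‖iteratedFDeriv ℝ j (𝓕 h) x‖ ≤ freqMoment h (j + (Module.finrank ℝ V + 1)) := by
  have hnorm (ξ : V) : ‖ξ‖ ≤ truncFreq ξ :=
    (le_mul_of_one_le_left (norm_nonneg ξ) (by linarith [Real.pi_gt_three])).trans
      (le_max_right _ _)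
  have hi' (k : ℕ) : Integrable fun ξ => ‖ξ‖ ^ k * ‖h ξ‖ :=
    (hi k).mono' ((continuous_norm.pow k).aestronglyMeasurable.mul hm.norm) (.of_forall fun ξ => by
      rw [Real.norm_of_nonneg (by positivity)]
      gcongr
      exact hnorm ξ)
  calc ‖iteratedFDeriv ℝ j (𝓕 h) x‖ ≤ ∫ ξ, (2 * Real.pi * ‖ξ‖) ^ j * ‖h ξ‖ :=
        norm_iteratedFDeriv_fourier_le hm hi' j x
    _ ≤ ∫ ξ, truncFreq ξ ^ j * ‖h ξ‖ :=
        integral_mono_of_nonneg (.of_forall fun ξ => by positivity) (hi j) (.of_forall fun ξ => by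
          beta_reduce
          gcongr
          exact le_max_right _ _)
    _ ≤ freqMoment h (j + (Module.finrank ℝ V + 1)) := by
        rw [freqMoment, integral_freqMeasure_truncFreq_pow_mul]
        linarith

end Moments

section LaplacianMoments

open Laplacian

variable {V : Type*} [NormedAddCommGroup V] [InnerProductSpace ℝ V] [FiniteDimensional ℝ V]
  [MeasurableSpace V] [BorelSpace V]

lemma eLpNorm_laplacian_eq_zero {F : Type*} [NormedAddCommGroup F] [NormedSpace ℝ F] {u : V → F}
    {p : ℝ≥0∞} (hu : Continuous u) (hp : p ≠ 0) (h0 : eLpNorm u p volume = 0) :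
    eLpNorm (Δ u) p volume = 0 := by
  have hu0 : u = 0 := (Continuous.ae_eq_iff_eq volume hu continuous_const).mp
    ((eLpNorm_eq_zero_iff hu.aestronglyMeasurable hp).mp h0)
  rw [hu0, show Δ (0 : V → F) = 0 from InnerProductSpace.laplacian_const, eLpNorm_zero]

variable {F : Type*} [NormedAddCommGroup F] [InnerProductSpace ℂ F] [CompleteSpace F]
  {f h : V → F} {p : ℝ≥0∞}

lemma eLpNorm_truncFreq_pow_mul_norm_le {ν : Measure V} (hν : ν ≤ volume)
    (hfh : IsWeakFourierInv f h) (hf : ContDiff ℝ ∞ f) (hp1 : 1 ≤ p) (hp2 : p ≤ 2)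
    (hLp : ∀ m, MemLp (Laplacian.laplacian^[m] f) p volume) (m : ℕ) :
    eLpNorm (fun ξ => truncFreq ξ ^ (2 * m) * ‖h ξ‖) 1 ν ≤
      (ν Set.univ + ν Set.univ ^ (1 / 2 : ℝ)) *
        (eLpNorm f p volume + eLpNorm (Laplacian.laplacian^[m] f) p volume) := by
  have hmult := hfh.iterate_laplacian hf hp1 hLp m
  calc eLpNorm (fun ξ => truncFreq ξ ^ (2 * m) * ‖h ξ‖) 1 ν
      ≤ eLpNorm (fun ξ => ‖h ξ‖ + ‖(-(2 * Real.pi * ‖ξ‖) ^ 2) ^ m • h ξ‖) 1 ν := by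
        refine eLpNorm_mono_real fun ξ => ?_
        have hnorm : ‖(-(2 * Real.pi * ‖ξ‖) ^ 2) ^ m • h ξ‖ =
            (2 * Real.pi * ‖ξ‖) ^ (2 * m) * ‖h ξ‖ := by
          rw [norm_smul, norm_pow, norm_neg, Real.norm_of_nonneg (by positivity), pow_mul]
        have := truncFreq_pos ξ
        rw [hnorm, ← one_add_mul, Real.norm_of_nonneg (by positivity)]
        gcongr
        exact truncFreq_pow_le ξ _
    _ ≤ eLpNorm h 1 ν + eLpNorm (fun ξ => (-(2 * Real.pi * ‖ξ‖) ^ 2) ^ m • h ξ) 1 ν := by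
        refine (eLpNorm_add_le (hfh.aestronglyMeasurable.mono_measure hν).norm
          (hmult.aestronglyMeasurable.mono_measure hν).norm le_rfl).trans_eq ?_
        rw [eLpNorm_norm, eLpNorm_norm]
    _ ≤ _ := by
        rw [mul_add]
        gcongr
        · exact hfh.eLpNorm_one_le hν hp1 hp2 (hLp 0)
        · exact hmult.eLpNorm_one_le hν hp1 hp2 (hLp m)

lemma integrable_truncFreq_pow_mul_norm {ν : Measure V} [IsFiniteMeasure ν] (hν : ν ≤ volume)
    (hfh : IsWeakFourierInv f h) (hf : ContDiff ℝ ∞ f) (hp1 : 1 ≤ p) (hp2 : p ≤ 2)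
    (hLp : ∀ m, MemLp (Laplacian.laplacian^[m] f) p volume) (j : ℕ) :
    Integrable (fun ξ => truncFreq ξ ^ j * ‖h ξ‖) ν := by
  have hmeas (k : ℕ) : AEStronglyMeasurable (fun ξ => truncFreq ξ ^ k * ‖h ξ‖) ν :=
    (continuous_truncFreq.pow k).aestronglyMeasurable.mul
      (hfh.aestronglyMeasurable.mono_measure hν).norm
  have heven : Integrable (fun ξ => truncFreq ξ ^ (2 * j) * ‖h ξ‖) ν :=
    memLp_one_iff_integrable.mp ⟨hmeas _, (eLpNorm_truncFreq_pow_mul_norm_le hν hfh hf hp1 hp2 hLp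
      j).trans_lt (ENNReal.mul_lt_top measure_univ_add_rpow_ne_top.lt_top
        (ENNReal.add_lt_top.mpr ⟨(hLp 0).2, (hLp j).2⟩))⟩
  refine heven.mono' (hmeas j) (.of_forall fun ξ => ?_)
  have := truncFreq_pos ξ
  rw [Real.norm_of_nonneg (by positivity)]
  gcongr
  · exact one_le_truncFreq ξ
  · omega

lemma freqMoment_sq_le (hfh : IsWeakFourierInv f h) (hf : ContDiff ℝ ∞ f) (hp1 : 1 ≤ p)
    (hp2 : p ≤ 2) (hLp : ∀ m, MemLp (Laplacian.laplacian^[m] f) p volume) (j : ℕ) :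
    freqMoment h (j + 1) ^ 2 ≤ freqMoment h j * freqMoment h (j + 2) :=
  one_add_integral_pow_mul_sq_le (fun ξ => (truncFreq_pos ξ).le) (fun ξ => norm_nonneg (h ξ))
    (integrable_truncFreq_pow_mul_norm freqMeasure_le_volume hfh hf hp1 hp2 hLp) j

lemma exists_ofReal_freqMoment_two_mul_le (hfh : IsWeakFourierInv f h)
    (hf : ContDiff ℝ ∞ f) (hp1 : 1 ≤ p) (hp2 : p ≤ 2)
    (hLp : ∀ m, MemLp (Laplacian.laplacian^[m] f) p volume) :
    ∃ C : ℝ≥0∞, 1 ≤ C ∧ C ≠ ⊤ ∧ ∀ m, ENNReal.ofReal (freqMoment h (2 * m)) ≤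
      C * max 1 (eLpNorm (Laplacian.laplacian^[m] f) p volume) := by
  set a : ℕ → ℝ≥0∞ := fun m => eLpNorm (Laplacian.laplacian^[m] f) p volume
  set ν := freqMeasure V
  set K := ν Set.univ + ν Set.univ ^ (1 / 2 : ℝ)
  refine ⟨1 + K * (a 0 + 1), le_self_add, ENNReal.add_ne_top.mpr ⟨ENNReal.one_ne_top,
    ENNReal.mul_ne_top measure_univ_add_rpow_ne_top
      (ENNReal.add_ne_top.mpr ⟨(hLp 0).2.ne, ENNReal.one_ne_top⟩)⟩,
    fun m => ?_⟩
  have hmoment : ENNReal.ofReal (∫ ξ, truncFreq ξ ^ (2 * m) * ‖h ξ‖ ∂ν) ≤ K * (a 0 + a m) := by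
    refine le_trans ?_
      (eLpNorm_truncFreq_pow_mul_norm_le freqMeasure_le_volume hfh hf hp1 hp2 hLp m)
    rw [eLpNorm_one_eq_lintegral_enorm]
    exact (Real.ofReal_le_enorm _).trans (enorm_integral_le_lintegral_enorm _)
  have ha : a m ≤ max 1 (a m) := le_max_right _ _
  have h1 : 1 ≤ max 1 (a m) := le_max_left _ _
  calc ENNReal.ofReal (freqMoment h (2 * m))
      ≤ 1 + ENNReal.ofReal (∫ ξ, truncFreq ξ ^ (2 * m) * ‖h ξ‖ ∂ν) :=
        ENNReal.ofReal_add_le.trans_eq (by rw [ENNReal.ofReal_one])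
    _ ≤ 1 + K * (a 0 + a m) := by gcongr
    _ ≤ max 1 (a m) + K * (a 0 * max 1 (a m) + max 1 (a m)) := by
        gcongr
        exact le_mul_of_one_le_right' h1
    _ = (1 + K * (a 0 + 1)) * max 1 (a m) := by ring

lemma not_summable_freqMoment_ratio (hfh : IsWeakFourierInv f h) (hf : ContDiff ℝ ∞ f)
    (hp1 : 1 ≤ p) (hp2 : p ≤ 2) (hLp : ∀ m, MemLp (Laplacian.laplacian^[m] f) p volume)
    (hsum : ∑' m : ℕ, eLpNorm (Laplacian.laplacian^[m + 1] f) p volume ^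
      (-(1 / (2 * ((m : ℝ) + 1)))) = ⊤) :
    ¬ Summable fun j => freqMoment h j / freqMoment h (j + 1) := by
  obtain ⟨C, hC1, hC, hMa⟩ := exists_ofReal_freqMoment_two_mul_le hfh hf hp1 hp2 hLp
  refine not_summable_ratio_of_even_le (fun m => (hLp m).2.ne) (fun m h0 => ?_) hsum
    (fun j => one_pos.trans_le (one_le_freqMoment h j)) (one_le_freqMoment h 0) hC1 hC hMa
  rw [Function.iterate_succ_apply']
  exact eLpNorm_laplacian_eq_zero (contDiff_iterate_laplacian hf m).continuous
    (one_pos.trans_le hp1).ne' h0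

end LaplacianMoments

section QuasiAnalytic

variable {V F : Type*} [NormedAddCommGroup V] [NormedSpace ℝ V] [NormedAddCommGroup F]
  [NormedSpace ℝ F] {f : V → F}

lemma iteratedDeriv_comp_line (hf : ContDiff ℝ ∞ f) (x₀ v : V) (j : ℕ) (t : ℝ) :
    iteratedDeriv j (fun s : ℝ => f (x₀ + s • v)) t =
      iteratedFDeriv ℝ j f (x₀ + t • v) (fun _ => v) := by
  have hcomp : (fun s : ℝ => f (x₀ + s • v)) =
      (fun y => f (x₀ + y)) ∘ ContinuousLinearMap.toSpanSingleton ℝ v := by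
    ext s
    simp
  have hshift : ContDiff ℝ ∞ fun y => f (x₀ + y) := hf.comp (contDiff_const.add contDiff_id)
  rw [iteratedDeriv_eq_iteratedFDeriv, hcomp,
    ContinuousLinearMap.iteratedFDeriv_comp_right _ hshift t (by exact_mod_cast le_top),
    iteratedFDeriv_comp_add_left]
  simp

lemma eq_zero_of_norm_iteratedFDeriv_le (hf : ContDiff ℝ ∞ f) {M : ℕ → ℝ} (hM : ∀ j, 0 < M j)
    (hconv : ∀ j, M (j + 1) ^ 2 ≤ M j * M (j + 2))
    (hbound : ∀ j x, ‖iteratedFDeriv ℝ j f x‖ ≤ M j)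
    (hdiv : ¬ Summable fun j => M j / M (j + 1)) {x₀ : V}
    (hzero : ∀ j, iteratedFDeriv ℝ j f x₀ = 0) : f = 0 := by
  ext x
  let v : V := ‖x - x₀‖⁻¹ • (x - x₀)
  have hv : ‖v‖ ≤ 1 := by
    rw [norm_smul, norm_inv, norm_norm]
    exact inv_mul_le_one
  have hx : x = x₀ + ‖x - x₀‖ • v := by
    rcases eq_or_ne x x₀ with rfl | hne
    · simp
    · rw [smul_inv_smul₀ (norm_ne_zero_iff.mpr (sub_ne_zero.mpr hne)), add_sub_cancel]
  have hg : ContDiff ℝ ∞ fun t : ℝ => f (x₀ + t • v) :=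
    hf.comp (contDiff_const.add (contDiff_id.smul contDiff_const))
  rw [hx]
  refine eq_zero_of_norm_iteratedDeriv_le hg hM hconv (fun j t => ?_) hdiv (fun j => ?_)
    (norm_nonneg (x - x₀))
  · rw [iteratedDeriv_comp_line hf]
    exact (ContinuousMultilinearMap.le_mul_prod_of_opNorm_le_of_le (hbound j _)
      fun _ => hv).trans_eq (by simp)
  · rw [iteratedDeriv_comp_line hf, zero_smul, add_zero, hzero, zero_apply]

end QuasiAnalytic

theorem theorem1p3_general {V F : Type*} [NormedAddCommGroup V] [InnerProductSpace ℝ V]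
    [FiniteDimensional ℝ V] [MeasurableSpace V] [BorelSpace V] [NormedAddCommGroup F]
    [InnerProductSpace ℂ F] [CompleteSpace F] {f : V → F} (hf : ContDiff ℝ ∞ f) {p : ℝ≥0∞}
    (hp1 : 1 ≤ p) (hp2 : p ≤ 2) (hLp : ∀ m, MemLp (Laplacian.laplacian^[m] f) p volume)
    (hsum : ∑' m : ℕ, eLpNorm (Laplacian.laplacian^[m + 1] f) p volume ^
      (-(1 / (2 * ((m : ℝ) + 1)))) = ⊤)
    {x₀ : V} (hvanish : ∀ k, iteratedFDeriv ℝ k f x₀ = 0) : f = 0 := by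
  obtain ⟨h, hfh, -⟩ := exists_isWeakFourierInv_eLpNorm_one_le (ν := volume) le_rfl hp1 hp2 (hLp 0)
  have hm := hfh.aestronglyMeasurable
  have hi (j : ℕ) : Integrable fun ξ => truncFreq ξ ^ j * ‖h ξ‖ :=
    integrable_freqMeasure_truncFreq_pow_mul_iff.mp
      (integrable_truncFreq_pow_mul_norm freqMeasure_le_volume hfh hf hp1 hp2 hLp _)
  have hfourier : f = FourierTransform.fourier h :=
    hfh.eq_fourier hf.continuous ((integrable_norm_iff hm).mp (by simpa using hi 0))
  let M (j : ℕ) : ℝ := freqMoment h (j + (Module.finrank ℝ V + 1))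
  have hbound (j : ℕ) (x : V) : ‖iteratedFDeriv ℝ j f x‖ ≤ M j := by
    rw [hfourier]
    exact norm_iteratedFDeriv_fourier_le_freqMoment hm hi j x
  have hconv (j : ℕ) : M (j + 1) ^ 2 ≤ M j * M (j + 2) := by
    simpa only [M, add_right_comm j _ (Module.finrank ℝ V + 1)]
      using freqMoment_sq_le hfh hf hp1 hp2 hLp _
  have hdiv : ¬ Summable fun j => M j / M (j + 1) := by
    simpa only [M, add_right_comm _ _ 1] using (summable_nat_add_iff _).not.mpr
      (not_summable_freqMoment_ratio hfh hf hp1 hp2 hLp hsum)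
  exact eq_zero_of_norm_iteratedFDeriv_le hf
    (fun j => one_pos.trans_le (one_le_freqMoment h _)) hconv hbound hdiv hvanish

theorem theorem1p3 (n : ℕ) (f : EuclideanSpace ℝ (Fin n) → ℂ) (hf : ContDiff ℝ ∞ f)
    (p : ℝ≥0∞) (hp1 : 1 ≤ p) (hp2 : p ≤ 2)
    (hLp : ∀ m : ℕ, MemLp (Laplacian.laplacian^[m] f) p volume)
    (hsum : ∑' m : ℕ,
      eLpNorm (Laplacian.laplacian^[m + 1] f) p volume ^ (-(1 / (2 * ((m : ℝ) + 1)))) = (⊤ : ℝ≥0∞))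
    (hvanish : ∃ x₀ : EuclideanSpace ℝ (Fin n),
      ∀ α : Fin n → ℕ, multiPartialDeriv α f x₀ = 0) :
    ∀ x : EuclideanSpace ℝ (Fin n), f x = 0 := by
  obtain ⟨x₀, hx₀⟩ := hvanish
  exact congrFun (theorem1p3_general hf hp1 hp2 hLp hsum
    (iteratedFDeriv_eq_zero_of_multiPartialDeriv hf hx₀))
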